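/- Let $G$ be a second-countable, locally compact (Hausdorff), non-compact group with identity $e$ and left Haar measure $\mu$, let $S\subset G$, $1\le p<\infty$, and let $\Gamma\subset\mathbb{C}$ be such that $\Gamma\setminus\{0\}\ne\emptyset$. Let $\omega:G\to(0,\infty)$ be a locally $p$-integrable weight (that is, $\omega$ is measurable and $\int_K\omega^p\,d\mu<\infty$ for every compact $K\subset G$) which is $S$-admissible, that is, $\operatorname{ess\,sup}_{t\in G}\omega(st)/\omega(t)<\infty$ for every $s\in S$. Let $L^p(G,\omega)$ be the space of (classes of) measurable $f:G\to\mathbb{C}$ with $\|f\|_{p,\omega}=\left(\int_G|f|^p\omega^p\,d\mu\right)^{1/p}<\infty$, and for $s\in S$ let $T_s$ be the left translation operator $(T_sf)(t)=f(s^{-1}t)$ on it. For $K\subset G$ put $\|\omega\|_{p,K}=\left(\int_K\omega^p\,d\mu\right)^{1/p}$. The following conditions are equivalent: (1) There is a $(\Gamma,S)$-dense vector in $L^p(G,\omega)$, that is, an $f\in L^p(G,\omega)$ such that $\{\lambda T_sf:\lambda\in\Gamma,\ s\in S\}$ is dense in $L^p(G,\omega)$. (2) For every increasing sequence $(F_n)_{n\ge1}$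 of compact subsets of $G$ of positive measure and for every sequence $(\delta_n)_{n\ge1}$ of positive numbers, there are sequences $(s_n)_{n\ge1}\subset S$, $(\lambda_n)_{n\ge1}\subset\Gamma\setminus\{0\}$ and a sequence of compact subsets $K_n\subset F_n$ such that the sets $s_n^{-1}F_n$, $n\ge1$, are pairwise disjoint, $\mu(F_n\setminus K_n)<\delta_n$ for all $n\ge 1$, and $$\sum_{n,k\ge0;\,n\ne k}\frac{|\lambda_n|^p}{|\lambda_k|^p}\,\|\omega\|^p_{p,\,s_ns_k^{-1}K_k}<+\infty,$$ where $s_0=e$, $\lambda_0=1$ and $K_0=\emptyset$. (3) For every $N\ge1$ there exist $N$ vectors $f_1,\dots,f_N\in L^p(G,\omega)$ such that the set $\{\lambda(T_sf_1,\dots,T_sf_N):\lambda\in\Gamma,\ s\in S\}$ is dense in the direct sum of $N$ copies of $L^p(G,\omega)$. -/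

import Mathlib

open MeasureTheory Set
open scoped ENNReal Pointwise

noncomputable section

namespace WeightedTranslates

variable {G : Type*} [Group G] [TopologicalSpace G] [MeasurableSpace G]

/-- A weight on `G`: a (strictly) positive function which is locally `p`-integrable with respect
to `μ`, that is, `p`-integrable (and in particular a.e. measurable) on every compact set. -/
structure IsWeight (μ : Measure G) (p : ℝ≥0∞) (ω : G → ℝ) : Prop where
  pos : ∀ t, 0 < ω t
  memLp_of_isCompact : ∀ K : Set G, IsCompact K → MemLp ω p (μ.restrict K)

/-- `M(s)`, the essential supremum over `t ∈ G` of `ω(st) / ω(t)`, with values in `[0, ∞]`. -/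
def translationBound (μ : Measure G) (ω : G → ℝ) (s : G) : ℝ≥0∞ :=
  essSup (fun t => ENNReal.ofReal (ω (s * t) / ω t)) μ

/-- The function `ω` is `S`-admissible if `M(s) < ∞` for all `s ∈ S`. -/
def IsAdmissible (μ : Measure G) (ω : G → ℝ) (S : Set G) : Prop :=
  ∀ s ∈ S, translationBound μ ω s < ∞

/-- The measure with density `ω ^ p` with respect to `μ`. -/
def weightedMeasure (μ : Measure G) (p : ℝ≥0∞) (ω : G → ℝ) : Measure G :=
  μ.withDensity (fun t => ENNReal.ofReal (ω t) ^ p.toReal)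

/-- The weighted space `L^p(G, ω)`: (classes of) measurable `f : G → ℂ` such that
`∫ |f| ^ p * ω ^ p ∂μ < ∞`, with the norm `(∫ |f| ^ p * ω ^ p ∂μ) ^ (1 / p)`.
Since a weight is positive, equality almost everywhere has the same meaning for `μ` and for the
measure with density `ω ^ p`. -/
abbrev WeightedLp (μ : Measure G) (p : ℝ≥0∞) (ω : G → ℝ) :=
  Lp ℂ p (weightedMeasure μ p ω)

section Translation

variable [IsTopologicalGroup G] [BorelSpace G]
variable {μ : Measure G} [μ.IsHaarMeasure] {p : ℝ≥0∞} {ω : G → ℝ} {S : Set G}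

theorem map_weightedMeasure_le (hω : IsWeight μ p ω) {s : G}
    (hs : translationBound μ ω s < ∞) :
    (weightedMeasure μ p ω).map (fun t => s⁻¹ * t) ≤
      (translationBound μ ω s ^ p.toReal) • weightedMeasure μ p ω := by
  have hC : translationBound μ ω s ^ p.toReal ≠ ∞ :=
    ENNReal.rpow_ne_top_of_nonneg ENNReal.toReal_nonneg hs.ne
  have hae : ∀ᵐ t ∂μ, ENNReal.ofReal (ω (s * t)) ^ p.toReal ≤
      translationBound μ ω s ^ p.toReal * ENNReal.ofReal (ω t) ^ p.toReal := by
    filter_upwards [ENNReal.ae_le_essSup (μ := μ)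
      (fun t => ENNReal.ofReal (ω (s * t) / ω t))] with t ht
    rw [← ENNReal.mul_rpow_of_nonneg _ _ ENNReal.toReal_nonneg]
    refine ENNReal.rpow_le_rpow ?_ ENNReal.toReal_nonneg
    calc ENNReal.ofReal (ω (s * t))
        = ENNReal.ofReal (ω (s * t) / ω t) * ENNReal.ofReal (ω t) := by
          rw [← ENNReal.ofReal_mul (div_pos (hω.pos _) (hω.pos _)).le,
            div_mul_cancel₀ _ (hω.pos t).ne']
      _ ≤ translationBound μ ω s * ENNReal.ofReal (ω t) := by
          gcongr
          exact ht
  refine Measure.le_iff.2 fun A hA => ?_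
  have hm : Measurable (fun t : G => s⁻¹ * t) := measurable_const_mul _
  rw [Measure.map_apply hm hA, Measure.smul_apply, weightedMeasure,
    withDensity_apply _ (hm hA), withDensity_apply _ hA, smul_eq_mul,
    ← lintegral_const_mul' _ _ hC, ← lintegral_indicator (hm hA), ← lintegral_indicator hA,
    ← lintegral_mul_left_eq_self _ s]
  refine lintegral_mono_ae ?_
  filter_upwards [hae] with t ht
  by_cases h : t ∈ A <;> simp [indicator, h, ht]

theorem memLp_translate (hω : IsWeight μ p ω) {s : G} (hs : translationBound μ ω s < ∞)
    (f : WeightedLp μ p ω) :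
    MemLp (fun t => f (s⁻¹ * t)) p (weightedMeasure μ p ω) := by
  have hC : translationBound μ ω s ^ p.toReal ≠ ∞ :=
    ENNReal.rpow_ne_top_of_nonneg ENNReal.toReal_nonneg hs.ne
  exact ((Lp.memLp f).of_measure_le_smul hC (map_weightedMeasure_le hω hs)).comp_of_map
    (measurable_const_mul _).aemeasurable

/-- The left translation `T_s` on `L^p(G, ω)`, `(T_s f)(t) = f(s⁻¹ t)`, for `s` with
`M(s) < ∞`. -/
def translate (hω : IsWeight μ p ω) (s : G) (hs : translationBound μ ω s < ∞)
    (f : WeightedLp μ p ω) : WeightedLp μ p ω :=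
  (memLp_translate hω hs f).toLp (fun t => f (s⁻¹ * t))

/-- The joint `(Γ, S)`-orbit `{λ (T_s f₁, …, T_s f_N) : λ ∈ Γ, s ∈ S}` of a family of vectors,
in the direct sum of copies of `L^p(G, ω)`. -/
def jointOrbit {ι : Type*} (hω : IsWeight μ p ω) (hS : IsAdmissible μ ω S) (Γ : Set ℂ)
    (f : ι → WeightedLp μ p ω) : Set (ι → WeightedLp μ p ω) :=
  {g | ∃ c ∈ Γ, ∃ s, ∃ hs : s ∈ S, g = c • fun i => translate hω s (hS s hs) (f i)}

/-- The `(Γ, S)`-orbit `{λ T_s f : λ ∈ Γ, s ∈ S}` of a vector. -/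
def orbit (hω : IsWeight μ p ω) (hS : IsAdmissible μ ω S) (Γ : Set ℂ)
    (f : WeightedLp μ p ω) : Set (WeightedLp μ p ω) :=
  {g | ∃ c ∈ Γ, ∃ s, ∃ hs : s ∈ S, g = c • translate hω s (hS s hs) f}

/-- A vector is `(Γ, S)`-dense if its `(Γ, S)`-orbit is dense in `L^p(G, ω)`. -/
def IsDenseVector [Fact (1 ≤ p)] (hω : IsWeight μ p ω) (hS : IsAdmissible μ ω S) (Γ : Set ℂ)
    (f : WeightedLp μ p ω) : Prop :=
  Dense (orbit hω hS Γ f)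

end Translation

/-- The local norm `‖ω‖_{p,K} = (∫_K |ω| ^ p ∂μ) ^ (1 / p)`, with values in `[0, ∞]`. -/
def localNorm (μ : Measure G) (p : ℝ≥0∞) (ω : G → ℝ) (K : Set G) : ℝ≥0∞ :=
  eLpNorm ω p (μ.restrict K)

/-- The term of index `(n, k)` of the double series:
`(|λ_n| ^ p / |λ_k| ^ p) * ‖ω‖_{p, s_n s_k⁻¹ K_k} ^ p` if `n ≠ k`, and `0` if `n = k`. -/
def seriesTerm (μ : Measure G) (p : ℝ≥0∞) (ω : G → ℝ) (s : ℕ → G) (l : ℕ → ℂ) (K : ℕ → Set G)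
    (n k : ℕ) : ℝ≥0∞ :=
  if n = k then 0 else
    ENNReal.ofReal (‖l n‖ ^ p.toReal / ‖l k‖ ^ p.toReal) *
      localNorm μ p ω ((s n * (s k)⁻¹) • K k) ^ p.toReal

/-- The condition on the weight. Sequences are indexed by `n ≥ 1`, and `s`, `l` and `K` are
extended to the index `0` by `s 0 = 1`, `l 0 = 1` and `K 0 = ∅`. -/
def SeriesCondition (μ : Measure G) (p : ℝ≥0∞) (ω : G → ℝ) (S : Set G) (Γ : Set ℂ) : Prop :=
  ∀ (F : ℕ → Set G) (δ : ℕ → ℝ),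
    MonotoneOn F (Ici 1) →
    (∀ n, 1 ≤ n → IsCompact (F n) ∧ 0 < μ (F n)) →
    (∀ n, 1 ≤ n → 0 < δ n) →
    ∃ (s : ℕ → G) (l : ℕ → ℂ) (K : ℕ → Set G),
      s 0 = 1 ∧ l 0 = 1 ∧ K 0 = ∅ ∧
      (∀ n, 1 ≤ n → s n ∈ S ∧ l n ∈ Γ \ {0} ∧
        IsCompact (K n) ∧ K n ⊆ F n ∧ μ (F n \ K n) < ENNReal.ofReal (δ n)) ∧
      (Ici 1).PairwiseDisjoint (fun n => (s n)⁻¹ • F n) ∧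
      ∑' (n : ℕ) (k : ℕ), seriesTerm μ p ω s l K n k < ∞

end WeightedTranslates

end

set_option linter.unusedSectionVars false

/-! Write `ν` for the measure with density `ω ^ p`, so that the double series is a sum of
`ν`-measures of translated sets with coefficients `|λ_n / λ_k| ^ p`.

From a dense vector `f` to the series: choose `λ_n T_{s_n} f` close to `1` on most of `F_n` and
small in norm off `F_n`, and let `K_n ⊆ F_n` be a compact set on which its modulus is at least
`1/2`. On `s_n s_k⁻¹ K_k` the modulus of `λ_n T_{s_n} f` is then at least `|λ_n| / (2 |λ_k|)`. These
sets are disjoint from each other and from `F_n`, so row `n` is at most `2 ^ p` times the mass of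
`λ_n T_{s_n} f` off `F_n` (`tsum_seriesTerm_le`). Disjointness of the `s_n⁻¹ F_n` means that `s_n`
avoids a compact set, which is always possible by `IsDenseVector.exists_approx_indicator`.

From the series to joint density: glue `λ_k⁻¹ T_{s_k}⁻¹ g_k` on the disjoint sets `s_k⁻¹ K_k`, where
the `g_k` are bounded truncations of a dense sequence of targets. Then `λ_n T_{s_n} f - g_n` lives
on `F_n \ K_n` and on the sets `s_n s_k⁻¹ K_k`, `k ≠ n`, and is controlled by row `n`
(`exists_translates_approx`). Since `s_n` and `λ_n` do not depend on the targets, `N` coordinates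
are treated at once. The case `N = 1` closes the circle. -/

namespace WeightedTranslates

open Filter Topology

/-! ### Haar measure and the weighted measure. -/

/-- `ε`-`δ` form of absolute continuity on a set of finite measure. -/
theorem exists_pos_measure_lt_of_absolutelyContinuous {α : Type*} [MeasurableSpace α]
    {μ ν : Measure α} [SigmaFinite μ] [SigmaFinite ν] (h : ν ≪ μ) {F : Set α} (hF : ν F ≠ ∞)
    {ε : ℝ≥0∞} (hε : ε ≠ 0) :
    ∃ δ > 0, ∀ A ⊆ F, μ A < δ → ν A < ε := by
  have key : ∀ A, ν A = ∫⁻ x in A, ν.rnDeriv μ x ∂μ := fun A => by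
    rw [← withDensity_apply', Measure.withDensity_rnDeriv_eq _ _ h]
  have hF' : ∫⁻ x, ν.rnDeriv μ x ∂(μ.restrict F) ≠ ∞ := by rwa [← key]
  obtain ⟨δ, hδ, H⟩ := exists_pos_setLIntegral_lt_of_measure_lt hF' hε
  refine ⟨δ, hδ, fun A hA hAδ => ?_⟩
  have := H A (by rwa [Measure.restrict_eq_self _ hA])
  rwa [Measure.restrict_restrict_of_subset hA, ← key] at this

section

variable {G : Type*} [Group G] [TopologicalSpace G] [IsTopologicalGroup G] [T2Space G]
  [LocallyCompactSpace G] [SecondCountableTopology G] [MeasurableSpace G] [BorelSpace G]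
  {μ : Measure G} [μ.IsHaarMeasure] {p : ℝ≥0∞} {ω : G → ℝ} {S : Set G} {Γ : Set ℂ}

theorem IsWeight.aemeasurable (hω : IsWeight μ p ω) : AEMeasurable ω μ := by
  have h : AEMeasurable ω (μ.restrict (⋃ n, compactCovering G n)) :=
    aemeasurable_iUnion_iff.2 fun n =>
      (hω.memLp_of_isCompact _ (isCompact_compactCovering G n)).1.aemeasurable
  rwa [iUnion_compactCovering, Measure.restrict_univ] at h

theorem weightedMeasure_absolutelyContinuous : weightedMeasure μ p ω ≪ μ :=
  withDensity_absolutelyContinuous _ _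

theorem IsWeight.absolutelyContinuous (hω : IsWeight μ p ω) : μ ≪ weightedMeasure μ p ω := by
  refine withDensity_absolutelyContinuous' (hω.aemeasurable.ennreal_ofReal.pow_const _)
    (ae_of_all _ fun t => ?_)
  exact (ENNReal.rpow_pos (ENNReal.ofReal_pos.2 (hω.pos t)) ENNReal.ofReal_ne_top).ne'

/-- Turns the double series into one about values of a measure, to be compared with integrals over
disjoint sets. -/
theorem localNorm_rpow [Fact (1 ≤ p)] (hp : p ≠ ∞) (hω : IsWeight μ p ω) (K : Set G) :
    localNorm μ p ω K ^ p.toReal = weightedMeasure μ p ω K := by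
  have h0 : p ≠ 0 := (zero_lt_one.trans_le (Fact.out : 1 ≤ p)).ne'
  rw [localNorm, eLpNorm_eq_lintegral_rpow_enorm_toReal h0 hp, ← ENNReal.rpow_mul,
    one_div_mul_cancel (ENNReal.toReal_ne_zero.2 ⟨h0, hp⟩), ENNReal.rpow_one, weightedMeasure,
    withDensity_apply']
  refine lintegral_congr fun t => ?_
  rw [Real.enorm_of_nonneg (hω.pos t).le]

theorem IsWeight.isFiniteMeasureOnCompacts [Fact (1 ≤ p)] (hp : p ≠ ∞) (hω : IsWeight μ p ω) :
    IsFiniteMeasureOnCompacts (weightedMeasure μ p ω) := by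
  refine ⟨fun K hK => ?_⟩
  rw [← localNorm_rpow hp hω]
  exact ENNReal.rpow_lt_top_of_nonneg ENNReal.toReal_nonneg (hω.memLp_of_isCompact K hK).2.ne

theorem IsWeight.sigmaFinite [Fact (1 ≤ p)] (hp : p ≠ ∞) (hω : IsWeight μ p ω) :
    SigmaFinite (weightedMeasure μ p ω) := by
  have := hω.isFiniteMeasureOnCompacts hp
  infer_instance

theorem coeFn_translate (hω : IsWeight μ p ω) (s : G) (hs : translationBound μ ω s < ∞)
    (f : WeightedLp μ p ω) :
    translate hω s hs f =ᵐ[weightedMeasure μ p ω] fun t => f (s⁻¹ * t) :=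
  MemLp.coeFn_toLp _

/-- Distances in `L^p` in terms of integrals. -/
theorem edist_rpow_toReal {α : Type*} [MeasurableSpace α] {ν : Measure α} [Fact (1 ≤ p)]
    (hp : p ≠ ∞) (f g : Lp ℂ p ν) :
    edist f g ^ p.toReal = ∫⁻ t, ‖f t - g t‖ₑ ^ p.toReal ∂ν := by
  have h0 : p ≠ 0 := (zero_lt_one.trans_le (Fact.out : 1 ≤ p)).ne'
  rw [Lp.edist_def, eLpNorm_eq_lintegral_rpow_enorm_toReal h0 hp, ← ENNReal.rpow_mul,
    one_div_mul_cancel (ENNReal.toReal_ne_zero.2 ⟨h0, hp⟩), ENNReal.rpow_one]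
  rfl

theorem toReal_pos_of_fact [Fact (1 ≤ p)] (hp : p ≠ ∞) : 0 < p.toReal :=
  ENNReal.toReal_pos (zero_lt_one.trans_le (Fact.out : 1 ≤ p)).ne' hp

theorem coeFn_measurable (f : WeightedLp μ p ω) : Measurable f :=
  (Lp.stronglyMeasurable f).measurable

/-- The orbit of a dense vector approximates every `p`-integrable function. -/
theorem IsDenseVector.exists_lintegral_lt [Fact (1 ≤ p)] (hp : p ≠ ∞) {hω : IsWeight μ p ω}
    {hS : IsAdmissible μ ω S} {f : WeightedLp μ p ω} (hf : IsDenseVector hω hS Γ f)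
    {g : G → ℂ} (hg : MemLp g p (weightedMeasure μ p ω)) {ε : ℝ≥0∞} (hε : ε ≠ 0) :
    ∃ c ∈ Γ, ∃ s ∈ S,
      ∫⁻ t, ‖c * f (s⁻¹ * t) - g t‖ₑ ^ p.toReal ∂(weightedMeasure μ p ω) < ε := by
  have hp0 := toReal_pos_of_fact hp
  obtain ⟨y, hy, c, hc, s, hs, rfl⟩ := EMetric.dense_iff.1 hf (hg.toLp g) (ε ^ (1 / p.toReal))
    (by
      rcases eq_or_ne ε ∞ with rfl | h
      · simp [hp0]
      · exact ENNReal.rpow_pos (pos_iff_ne_zero.2 hε) h)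
  refine ⟨c, hc, s, hs, ?_⟩
  rw [Metric.mem_eball] at hy
  have := ENNReal.rpow_lt_rpow hy hp0
  rw [edist_rpow_toReal hp, ← ENNReal.rpow_mul, one_div_mul_cancel hp0.ne',
    ENNReal.rpow_one] at this
  refine lt_of_eq_of_lt (lintegral_congr_ae ?_) this
  filter_upwards [Lp.coeFn_smul c (translate hω s (hS s hs) f),
    coeFn_translate hω s (hS s hs) f, hg.coeFn_toLp] with t h1 h2 h3
  rw [h1, h3, Pi.smul_apply, h2, smul_eq_mul]

/-- A function which is small in the weighted `L^p` space is small in measure on compact sets. -/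
theorem IsWeight.exists_measure_norm_ge_lt [Fact (1 ≤ p)] (hp : p ≠ ∞) (hω : IsWeight μ p ω)
    {F : Set G} (hF : IsCompact F) {a : ℝ} (ha : 0 < a) {b : ℝ≥0∞} (hb : b ≠ 0) :
    ∃ κ > 0, ∀ h : G → ℂ, AEMeasurable h (weightedMeasure μ p ω) →
      ∫⁻ t, ‖h t‖ₑ ^ p.toReal ∂(weightedMeasure μ p ω) < κ → μ {t ∈ F | a ≤ ‖h t‖} < b := by
  have := hω.sigmaFinite hp
  have hp0 := toReal_pos_of_fact hp
  obtain ⟨δ, hδ, H⟩ := exists_pos_measure_lt_of_absolutelyContinuous hω.absolutelyContinuous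
    hF.measure_lt_top.ne hb
  have ha' : ENNReal.ofReal a ^ p.toReal ≠ 0 :=
    (ENNReal.rpow_pos (ENNReal.ofReal_pos.2 ha) ENNReal.ofReal_ne_top).ne'
  have ha'' : ENNReal.ofReal a ^ p.toReal ≠ ∞ :=
    ENNReal.rpow_ne_top_of_nonneg hp0.le ENNReal.ofReal_ne_top
  refine ⟨ENNReal.ofReal a ^ p.toReal * δ, ENNReal.mul_pos ha' hδ.ne', fun h hm hh => ?_⟩
  refine H _ (sep_subset _ _) ?_
  have h1 := (mul_meas_ge_le_lintegral₀ (hm.enorm.pow_const p.toReal)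
    (ENNReal.ofReal a ^ p.toReal)).trans_lt hh
  refine lt_of_le_of_lt (measure_mono ?_) ((ENNReal.mul_lt_mul_iff_right ha' ha'').1 h1)
  rintro t ⟨-, ht⟩
  refine ENNReal.rpow_le_rpow ?_ hp0.le
  rw [← ofReal_norm]
  exact ENNReal.ofReal_le_ofReal ht

theorem memLp_indicator_const_of_isCompact [Fact (1 ≤ p)] (hp : p ≠ ∞) (hω : IsWeight μ p ω)
    {F : Set G} (hF : IsCompact F) (c : ℂ) :
    MemLp (F.indicator fun _ => c) p (weightedMeasure μ p ω) := by
  have := hω.isFiniteMeasureOnCompacts hp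
  exact memLp_indicator_const p hF.measurableSet c (Or.inr hF.measure_lt_top.ne)

theorem exists_isCompact_disjoint [NoncompactSpace G] {L : Set G}
    (hL : IsCompact L) : ∃ F, IsCompact F ∧ 0 < μ F ∧ Disjoint F L := by
  have hne : L ≠ univ := hL.ne_univ
  obtain ⟨x, hx⟩ := (ne_univ_iff_exists_notMem L).1 hne
  obtain ⟨F, hF, hxF, hFL⟩ := exists_compact_subset hL.isClosed.isOpen_compl hx
  exact ⟨F, hF, (isOpen_interior.measure_pos μ ⟨x, hxF⟩).trans_le (measure_mono interior_subset),
    disjoint_left.2 fun y hy => hFL hy⟩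

end


/-! ### Approximation along the orbit of a dense vector. -/

section

variable {G : Type*} [Group G] [TopologicalSpace G] [IsTopologicalGroup G] [T2Space G]
  [LocallyCompactSpace G] [SecondCountableTopology G] [MeasurableSpace G] [BorelSpace G]
  {μ : Measure G} [μ.IsHaarMeasure] {p : ℝ≥0∞} {ω : G → ℝ} {S : Set G} {Γ : Set ℂ}

/-- The orbit of a dense vector approximates every `p`-integrable function, simultaneously in norm
and in measure on a compact set. -/
theorem IsDenseVector.exists_approx [Fact (1 ≤ p)] (hp : p ≠ ∞) {hω : IsWeight μ p ω}
    {hS : IsAdmissible μ ω S} {f : WeightedLp μ p ω} (hf : IsDenseVector hω hS Γ f)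
    {g : G → ℂ} (hg : MemLp g p (weightedMeasure μ p ω)) {ε : ℝ≥0∞} (hε : ε ≠ 0)
    {F : Set G} (hF : IsCompact F) {a : ℝ} (ha : 0 < a) {b : ℝ≥0∞} (hb : b ≠ 0) :
    ∃ c ∈ Γ, ∃ s ∈ S,
      ∫⁻ t, ‖c * f (s⁻¹ * t) - g t‖ₑ ^ p.toReal ∂(weightedMeasure μ p ω) < ε ∧
      μ {t ∈ F | a ≤ ‖c * f (s⁻¹ * t) - g t‖} < b := by
  obtain ⟨κ, hκ, H⟩ := hω.exists_measure_norm_ge_lt hp hF ha hb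
  obtain ⟨c, hc, s, hs, h⟩ := hf.exists_lintegral_lt hp hg (ε := min ε κ)
    (lt_min (pos_iff_ne_zero.2 hε) hκ).ne'
  refine ⟨c, hc, s, hs, h.trans_le (min_le_left _ _), H _ ?_ (h.trans_le (min_le_right _ _))⟩
  have h1 : Measurable fun t => c * f (s⁻¹ * t) :=
    ((coeFn_measurable f).comp (measurable_const_mul _)).const_mul c
  exact h1.aemeasurable.sub hg.1.aemeasurable

/-- A dense vector does not vanish almost everywhere outside a compact set. -/
theorem IsDenseVector.measure_support_diff_pos [NoncompactSpace G] [Fact (1 ≤ p)] (hp : p ≠ ∞)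
    {hω : IsWeight μ p ω} {hS : IsAdmissible μ ω S} {f : WeightedLp μ p ω}
    (hf : IsDenseVector hω hS Γ f) {L : Set G} (hL : IsCompact L) :
    0 < μ ({x | f x ≠ 0} \ L) := by
  by_contra h0
  replace h0 : μ ({x | f x ≠ 0} \ L) = 0 := by simpa using h0
  obtain ⟨F, hF, hFpos, -⟩ := exists_isCompact_disjoint (μ := μ) (isCompact_empty (X := G))
  -- A translate of `L` meeting `F` lies in `F * L⁻¹ * L`, so it misses `F'`. If `f` vanished a.e.
  -- off `L`, approximating the indicator of `F ∪ F'` would force one translate of `L` to meet both.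
  obtain ⟨F', hF', hFpos', hdisj⟩ := exists_isCompact_disjoint (μ := μ) ((hF.mul hL.inv).mul hL)
  obtain ⟨c, -, s, -, -, h⟩ := hf.exists_approx hp
    (memLp_indicator_const_of_isCompact hp hω (hF.union hF') 1) one_ne_zero
    (hF.union hF') one_pos (lt_min hFpos hFpos').ne'
  have key : ∀ E ⊆ F ∪ F', min (μ F) (μ F') ≤ μ E → ∃ t ∈ E, s⁻¹ * t ∈ L := by
    intro E hE hμE
    by_contra! hcon
    refine (hμE.trans ?_).not_gt h
    have hnull : μ ((fun t => s⁻¹ * t) ⁻¹' ({x | f x ≠ 0} \ L)) = 0 := by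
      rw [measure_preimage_mul, h0]
    calc μ E ≤ μ ({t ∈ F ∪ F' | 1 ≤ ‖c * f (s⁻¹ * t) - (F ∪ F').indicator (fun _ => (1 : ℂ)) t‖}
          ∪ (fun t => s⁻¹ * t) ⁻¹' ({x | f x ≠ 0} \ L)) := by
          refine measure_mono fun t ht => ?_
          by_cases hft : f (s⁻¹ * t) = 0
          · left
            refine ⟨hE ht, ?_⟩
            simp [hft, indicator_of_mem (hE ht)]
          · right
            exact ⟨hft, hcon t ht⟩
      _ ≤ _ := (measure_union_le _ _).trans (by rw [hnull, add_zero])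
  obtain ⟨t, ht, htL⟩ := key F subset_union_left (min_le_left _ _)
  obtain ⟨t', ht', htL'⟩ := key F' subset_union_right (min_le_right _ _)
  refine disjoint_left.1 hdisj ht' ?_
  refine ⟨t * (s⁻¹ * t)⁻¹, ⟨t, ht, _, inv_mem_inv.2 htL, rfl⟩, _, htL', ?_⟩
  simp

/-- The sets where `‖f‖ > 1 / (n + 1)` exhaust the support, so one has positive measure off `U`;
inner regularity gives `A`. -/
theorem exists_isCompact_forall_lt_norm {f : G → ℂ} (hf : Measurable f) {U : Set G}
    (hU : MeasurableSet U) (h : 0 < μ ({x | f x ≠ 0} \ U)) :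
    ∃ η > 0, ∃ A, IsCompact A ∧ 0 < μ A ∧ Disjoint A U ∧ ∀ x ∈ A, η < ‖f x‖ := by
  have hU' : {x | f x ≠ 0} \ U ⊆ ⋃ n : ℕ, {x | 1 / ((n : ℝ) + 1) < ‖f x‖} \ U := by
    rintro x ⟨hx, hxU⟩
    obtain ⟨n, hn⟩ := exists_nat_one_div_lt (norm_pos_iff.2 hx)
    exact mem_iUnion.2 ⟨n, hn, hxU⟩
  obtain ⟨n, hn⟩ := exists_measure_pos_of_not_measure_iUnion_null (h.trans_le (measure_mono hU')).ne'
  obtain ⟨A, hA, hAc, hApos⟩ := MeasurableSet.exists_lt_isCompact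
    ((measurableSet_lt measurable_const hf.norm).diff hU) hn
  exact ⟨1 / ((n : ℝ) + 1), Nat.one_div_pos_of_nat, A, hAc, hApos,
    disjoint_left.2 fun x hx => (hA hx).2, fun x hx => (hA hx).1⟩

/-- Continuity from above: the superlevel sets in `L` have finite measure and decrease to `∅`. -/
theorem exists_measure_norm_gt_lt {f : G → ℂ} (hf : Measurable f) {L : Set G} (hL : IsCompact L)
    {b : ℝ≥0∞} (hb : b ≠ 0) : ∃ R : ℝ, 0 < R ∧ μ {x ∈ L | R < ‖f x‖} < b := by
  have h := tendsto_measure_iInter_atTop (μ := μ) (s := fun n : ℕ => {x ∈ L | (n : ℝ) + 1 < ‖f x‖})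
    (fun n => (hL.measurableSet.inter
      (measurableSet_lt measurable_const hf.norm)).nullMeasurableSet)
    (fun m n hmn x hx => ⟨hx.1, lt_of_le_of_lt (by gcongr) hx.2⟩)
    ⟨0, ((measure_mono (sep_subset _ _)).trans_lt hL.measure_lt_top).ne⟩
  have hempty : ⋂ n : ℕ, {x ∈ L | (n : ℝ) + 1 < ‖f x‖} = ∅ := by
    refine eq_empty_of_forall_notMem fun x hx => ?_
    obtain ⟨n, hn⟩ := exists_nat_gt ‖f x‖
    have := (mem_iInter.1 hx n).2
    linarith
  rw [hempty, measure_empty] at h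
  obtain ⟨n, hn⟩ := (h.eventually_lt_const (pos_iff_ne_zero.2 hb)).exists
  exact ⟨n + 1, by positivity, hn⟩

/-- The approximation of the indicator function of a compact set by the orbit of a dense vector can
be achieved by translations outside a given compact set. -/
theorem IsDenseVector.exists_approx_indicator [NoncompactSpace G] [Fact (1 ≤ p)] (hp : p ≠ ∞)
    {hω : IsWeight μ p ω} {hS : IsAdmissible μ ω S} {f : WeightedLp μ p ω}
    (hf : IsDenseVector hω hS Γ f) {F : Set G} (hF : IsCompact F) (hFpos : 0 < μ F)
    {C : Set G} (hC : IsCompact C) {ε b : ℝ≥0∞} (hε : ε ≠ 0) (hb : b ≠ 0) :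
    ∃ c ∈ Γ, ∃ s ∈ S, s ∉ C ∧
      ∫⁻ t in Fᶜ, ‖c * f (s⁻¹ * t)‖ₑ ^ p.toReal ∂(weightedMeasure μ p ω) < ε ∧
      μ {t ∈ F | 1 / 2 ≤ ‖c * f (s⁻¹ * t) - 1‖} < b := by
  have hp0 := toReal_pos_of_fact hp
  have hp1 : 1 ≤ p.toReal := by
    simpa using ENNReal.toReal_mono hp (Fact.out : 1 ≤ p)
  have hfm := coeFn_measurable f
  have := hω.isFiniteMeasureOnCompacts hp
  set ν := weightedMeasure μ p ω with hν
  -- The target will be `1` on `F` and a small constant `r` on `C * A`, which is disjoint from `F`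
  -- because `A` avoids `C⁻¹ * F`. A translation by `s ∈ C` carries `A`, where `‖f‖ > η`, into `C *
  -- A`; this makes `c` too small to reach values near `1` on `F`.
  obtain ⟨η, hη, A, hA, hApos, hAdisj, hAη⟩ := exists_isCompact_forall_lt_norm (μ := μ) hfm
    (hC.inv.mul hF).measurableSet (hf.measure_support_diff_pos hp (hC.inv.mul hF))
  have hFA : Disjoint F (C * A) := by
    rw [disjoint_left]
    rintro _ hx ⟨c, hc, a, ha, rfl⟩
    exact disjoint_left.1 hAdisj ha ⟨c⁻¹, inv_mem_inv.2 hc, c * a, hx, by simp⟩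
  have hCA : IsCompact (C * A) := hC.mul hA
  have hF2 : μ F / 2 ≠ 0 := (ENNReal.half_pos hFpos.ne').ne'
  obtain ⟨R, hR, hRF⟩ := exists_measure_norm_gt_lt (μ := μ) hfm (hC.inv.mul hF) hF2
  -- choice of a small multiple of the indicator function of `C * A`
  obtain ⟨r, hr, hr2⟩ : ∃ r : ℝ, 0 < r ∧ (r < η / (4 * R) ∧
      2 ^ (p.toReal - 1) * (ENNReal.ofReal r ^ p.toReal * ν (C * A)) < ε / 2) := by
    have ht : Filter.Tendsto (fun r : ℝ => 2 ^ (p.toReal - 1) *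
        (ENNReal.ofReal r ^ p.toReal * ν (C * A))) (nhds 0)
        (nhds (2 ^ (p.toReal - 1) * (ENNReal.ofReal 0 ^ p.toReal * ν (C * A)))) := by
      refine ENNReal.Tendsto.const_mul (ENNReal.Tendsto.mul_const ?_ (Or.inr ?_)) (Or.inr ?_)
      · exact (ENNReal.continuous_rpow_const.comp ENNReal.continuous_ofReal).tendsto _
      · exact hCA.measure_lt_top.ne
      · exact ENNReal.rpow_ne_top_of_nonneg (by linarith) (by simp)
    rw [ENNReal.ofReal_zero, ENNReal.zero_rpow_of_pos hp0, zero_mul, mul_zero] at ht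
    have h1 := (ht.eventually_lt_const (ENNReal.half_pos hε)).filter_mono
      (nhdsWithin_le_nhds (s := Ioi 0))
    have h2 : ∀ᶠ r : ℝ in nhdsWithin 0 (Ioi 0), r < η / (4 * R) :=
      (gt_mem_nhds (by positivity)).filter_mono nhdsWithin_le_nhds
    exact ((eventually_mem_nhdsWithin (s := Ioi (0 : ℝ))).and (h2.and h1)).exists
  have hg : MemLp (F.indicator (fun _ => (1 : ℂ)) + (C * A).indicator fun _ => (r : ℂ)) p ν :=
    (memLp_indicator_const_of_isCompact hp hω hF 1).add
      (memLp_indicator_const_of_isCompact hp hω hCA r)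
  set g := F.indicator (fun _ => (1 : ℂ)) + (C * A).indicator fun _ => (r : ℂ) with hgdef
  have hgF : ∀ t ∈ F, g t = 1 := fun t ht => by
    simp [hgdef, ht, indicator_of_notMem (disjoint_left.1 hFA ht)]
  have hgCA : ∀ t ∈ C * A, g t = r := fun t ht => by
    simp [hgdef, indicator_of_mem ht, indicator_of_notMem (disjoint_right.1 hFA ht)]
  have h2top : (2 : ℝ≥0∞) ^ (p.toReal - 1) ≠ ∞ :=
    ENNReal.rpow_ne_top_of_nonneg (by linarith) (by simp)
  have h2pos : (2 : ℝ≥0∞) ^ (p.toReal - 1) ≠ 0 := by simp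
  -- The divisor `2 ^ (p - 1)` pays for `(x + y) ^ p ≤ 2 ^ (p - 1) * (x ^ p + y ^ p)`. The bounds `μ
  -- F / 2` and `μ A` on the exceptional set serve the contradiction when `s ∈ C`; `b` serves the
  -- conclusion.
  obtain ⟨c, hc, s, hs, hint, hmeas⟩ := hf.exists_approx hp hg
    (ε := ε / 2 / 2 ^ (p.toReal - 1))
    (ENNReal.div_pos (ENNReal.half_pos hε).ne' h2top).ne'
    (hF.union hCA) (lt_min hr one_half_pos)
    (b := min b (min (μ F / 2) (μ A)))
    (lt_min (pos_iff_ne_zero.2 hb) (lt_min (pos_iff_ne_zero.2 hF2) hApos)).ne'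
  have hFmeas : μ {t ∈ F | 1 / 2 ≤ ‖c * f (s⁻¹ * t) - 1‖} < min b (min (μ F / 2) (μ A)) := by
    refine (measure_mono fun t ht => ?_).trans_lt hmeas
    exact ⟨Or.inl ht.1, by rw [hgF t ht.1]; exact (min_le_right _ _).trans ht.2⟩
  refine ⟨c, hc, s, hs, fun hsC => ?_, ?_, hFmeas.trans_le (min_le_left _ _)⟩
  · obtain ⟨x, hxA, hx⟩ : ∃ x ∈ A, ‖c * f x - r‖ < r := by
      by_contra! hcon
      have h1 : μ A ≤ μ {t ∈ F ∪ C * A | min r (1 / 2) ≤ ‖c * f (s⁻¹ * t) - g t‖} := by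
        rw [← measure_preimage_mul μ s⁻¹ A]
        refine measure_mono fun t ht => ?_
        have htCA : t ∈ C * A := ⟨s, hsC, _, ht, by simp⟩
        exact ⟨Or.inr htCA, (min_le_left _ _).trans (by rw [hgCA t htCA]; exact hcon _ ht)⟩
      exact h1.not_gt (hmeas.trans_le ((min_le_right _ _).trans (min_le_right _ _)))
    have hcη : ‖c‖ * η < 2 * r := by
      have h1 : ‖c * f x‖ ≤ ‖c * f x - r‖ + ‖(r : ℂ)‖ := by
        simpa using norm_add_le (c * f x - r) (r : ℂ)
      rw [norm_mul, Complex.norm_real, Real.norm_of_nonneg hr.le] at h1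
      have := mul_le_mul_of_nonneg_left (hAη x hxA).le (norm_nonneg c)
      linarith
    have hcR : ‖c‖ * R < 1 / 2 := by
      have h1 : 4 * R * r < η := by
        have := hr2.1
        rw [lt_div_iff₀ (by positivity)] at this
        linarith
      have h2 : ‖c‖ * R * η < 1 / 2 * η := by
        calc ‖c‖ * R * η = (‖c‖ * η) * R := by ring
          _ < 2 * r * R := by gcongr
          _ < 1 / 2 * η := by linarith
      exact lt_of_mul_lt_mul_right h2 hη.le
    -- Where `c * f (s⁻¹ * t)` is within `1/2` of `1`, the bound `‖c‖ * R < 1/2` forces `‖f (s⁻¹ *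
    -- t)‖ > R`. Thus `F` is covered by two sets of measure below `μ F / 2`.
    have hcov : F ⊆ {t ∈ F | 1 / 2 ≤ ‖c * f (s⁻¹ * t) - 1‖} ∪
        (fun t => s⁻¹ * t) ⁻¹' {x ∈ C⁻¹ * F | R < ‖f x‖} := by
      intro t ht
      by_cases h1 : 1 / 2 ≤ ‖c * f (s⁻¹ * t) - 1‖
      · exact Or.inl ⟨ht, h1⟩
      · right
        refine ⟨⟨s⁻¹, inv_mem_inv.2 hsC, t, ht, rfl⟩, ?_⟩
        by_contra! h2
        have h3 : ‖c * f (s⁻¹ * t)‖ ≤ ‖c‖ * R := by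
          rw [norm_mul]
          gcongr
        have h4 : (1 : ℝ) ≤ ‖c * f (s⁻¹ * t) - 1‖ + ‖c * f (s⁻¹ * t)‖ := by
          have := norm_sub_norm_le (1 : ℂ) (c * f (s⁻¹ * t))
          rw [norm_one, norm_sub_rev] at this
          linarith
        linarith
    have := calc μ F ≤ _ := measure_mono hcov
      _ ≤ _ := measure_union_le _ _
      _ < μ F / 2 + μ F / 2 := by
        refine ENNReal.add_lt_add
          (hFmeas.trans_le ((min_le_right _ _).trans (min_le_left _ _))) ?_
        rw [measure_preimage_mul]
        exact hRF
    rw [ENNReal.add_halves] at this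
    exact this.false
  · have hm : AEMeasurable (fun t => ‖c * f (s⁻¹ * t) - g t‖ₑ ^ p.toReal) (ν.restrict Fᶜ) :=
      (((((hfm.comp (measurable_const_mul s⁻¹)).const_mul c).aemeasurable.sub
        hg.1.aemeasurable).enorm).pow_const _).mono_measure Measure.restrict_le_self
    calc ∫⁻ t in Fᶜ, ‖c * f (s⁻¹ * t)‖ₑ ^ p.toReal ∂ν
        ≤ ∫⁻ t in Fᶜ, (2 ^ (p.toReal - 1) * ‖c * f (s⁻¹ * t) - g t‖ₑ ^ p.toReal +
            2 ^ (p.toReal - 1) * ((C * A).indicator (fun _ => ENNReal.ofReal r ^ p.toReal) t)) ∂ν := by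
          refine setLIntegral_mono' hF.measurableSet.compl fun t ht => ?_
          have h1 : ‖c * f (s⁻¹ * t)‖ₑ ≤ ‖c * f (s⁻¹ * t) - g t‖ₑ + ‖g t‖ₑ := by
            simpa using enorm_add_le (c * f (s⁻¹ * t) - g t) (g t)
          have h2 : ‖g t‖ₑ ^ p.toReal =
              (C * A).indicator (fun _ => ENNReal.ofReal r ^ p.toReal) t := by
            by_cases htA : t ∈ C * A
            · rw [hgCA t htA, indicator_of_mem htA, ← ofReal_norm, Complex.norm_real,
                Real.norm_of_nonneg hr.le]
            · have hg0 : g t = 0 := by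
                simp [hgdef, indicator_of_notMem htA, indicator_of_notMem ht]
              rw [hg0, indicator_of_notMem htA, enorm_zero, ENNReal.zero_rpow_of_pos hp0]
          rw [← h2, ← mul_add]
          exact (ENNReal.rpow_le_rpow h1 hp0.le).trans (ENNReal.rpow_add_le_mul_rpow_add_rpow _ _ hp1)
      _ = 2 ^ (p.toReal - 1) * ∫⁻ t in Fᶜ, ‖c * f (s⁻¹ * t) - g t‖ₑ ^ p.toReal ∂ν +
            2 ^ (p.toReal - 1) * ∫⁻ t in Fᶜ,
              ((C * A).indicator (fun _ => ENNReal.ofReal r ^ p.toReal) t) ∂ν := by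
          rw [lintegral_add_left' (hm.const_mul _), lintegral_const_mul' _ _ h2top,
            lintegral_const_mul' _ _ h2top]
      _ ≤ 2 ^ (p.toReal - 1) * ∫⁻ t, ‖c * f (s⁻¹ * t) - g t‖ₑ ^ p.toReal ∂ν +
            2 ^ (p.toReal - 1) * (ENNReal.ofReal r ^ p.toReal * ν (C * A)) := by
          gcongr
          exact Measure.restrict_le_self
          · refine (setLIntegral_le_lintegral _ _).trans ?_
            rw [lintegral_indicator hCA.measurableSet, setLIntegral_const]
      _ < ε / 2 + ε / 2 := by
          refine ENNReal.add_lt_add ?_ hr2.2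
          rw [mul_comm]
          exact (ENNReal.lt_div_iff_mul_lt (Or.inl h2pos) (Or.inl h2top)).1 hint
      _ = ε := ENNReal.add_halves ε

end


/-! ### From a dense vector to the double series. -/

/-- Strong recursion. The history is passed as a full sequence padded by an arbitrary element, which
is harmless since only indices `k < n` are constrained. -/
theorem exists_seq_of_forall_exists {α : Type*} [Nonempty α] (P : ℕ → α → Prop)
    (r : ℕ → ℕ → α → α → Prop)
    (h : ∀ (n : ℕ) (x : ℕ → α), ∃ y, P n y ∧ ∀ k < n, r n k y (x k)) :
    ∃ x : ℕ → α, ∀ n, P n (x n) ∧ ∀ k < n, r n k (x n) (x k) := by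
  choose g hgP hgr using h
  let step : (n : ℕ) → ((k : ℕ) → k < n → α) → α :=
    fun n ih => g n fun k => if hk : k < n then ih k hk else Classical.arbitrary α
  let x : ℕ → α := fun n => Nat.strongRecOn n step
  have hx : ∀ n, x n = g n fun k => if k < n then x k else Classical.arbitrary α := fun n => by
    have : x n = step n fun k _ => x k := Nat.strongRecOn_eq _ _
    rw [this]
    simp only [step, dite_eq_ite]
  refine ⟨x, fun n => ⟨by rw [hx]; exact hgP _ _, fun k hk => ?_⟩⟩
  have := hgr n (fun k => if k < n then x k else Classical.arbitrary α) k hk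
  rwa [← hx, if_pos hk] at this

section

variable {G : Type*} [Group G] [TopologicalSpace G] [IsTopologicalGroup G] [T2Space G]
  [LocallyCompactSpace G] [SecondCountableTopology G] [MeasurableSpace G] [BorelSpace G]
  {μ : Measure G} [μ.IsHaarMeasure] {p : ℝ≥0∞} {ω : G → ℝ} {S : Set G} {Γ : Set ℂ}

/-- A row of the double series is controlled by the part of a translate lying off `E`. -/
theorem tsum_seriesTerm_le [Fact (1 ≤ p)] (hp : p ≠ ∞) (hω : IsWeight μ p ω) {f : G → ℂ}
    {s : ℕ → G} {l : ℕ → ℂ} {K F : ℕ → Set G}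
    (hK : ∀ k, MeasurableSet (K k)) (hKF : ∀ k, K k ⊆ F k)
    (hF : Pairwise (Function.onFun Disjoint fun k => (s k)⁻¹ • F k)) 
    (hl : ∀ k, ∀ t ∈ K k, 1 / 2 ≤ ‖l k * f ((s k)⁻¹ * t)‖) (n : ℕ) :
    ∑' k, seriesTerm μ p ω s l K n k ≤ 2 ^ p.toReal *
      ∫⁻ t in (F n)ᶜ, ‖l n * f ((s n)⁻¹ * t)‖ₑ ^ p.toReal ∂(weightedMeasure μ p ω) := by
  have hp0 := toReal_pos_of_fact hp
  set ν := weightedMeasure μ p ω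
  have h2top : (2 : ℝ≥0∞) ^ p.toReal ≠ ∞ := ENNReal.rpow_ne_top_of_nonneg hp0.le (by simp)
  set B : ℕ → Set G := fun k => if n = k then ∅ else (s n * (s k)⁻¹) • K k with hB
  have hBm : ∀ k, MeasurableSet (B k) := fun k => by
    by_cases hk : n = k
    · simp [hB, hk]
    · simpa [hB, hk] using (hK k).const_smul _
  have hBsub : ∀ k, B k ⊆ s n • (s k)⁻¹ • F k := fun k => by
    by_cases hk : n = k
    · simp [hB, hk]
    · simp only [hB, hk, if_false, smul_smul]
      exact smul_set_mono (hKF k)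
  -- Left translation by `s n` preserves disjointness and sends `(s n)⁻¹ • F n` to `F n`, so the `B
  -- k` also avoid `F n`.
  have hdisj : Pairwise (Function.onFun Disjoint B) := fun i j hij =>
    (Set.disjoint_smul_set.2 (hF hij)).mono (hBsub i) (hBsub j)
  have hBF : ∀ k, B k ⊆ (F n)ᶜ := fun k => by
    by_cases hk : n = k
    · simp [hB, hk]
    · refine (hBsub k).trans (subset_compl_iff_disjoint_left.2 ?_)
      have := Set.disjoint_smul_set (a := s n).2 (hF hk)
      simpa using this
  -- For `t ∈ B k` with `k ≠ n`, the point `s k * (s n)⁻¹ * t` lies in `K k`, so `‖l k * f ((s n)⁻¹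
  -- * t)‖ ≥ 1/2`, that is, `‖l n‖ / ‖l k‖ ≤ 2 * ‖l n * f ((s n)⁻¹ * t)‖`.
  have hterm : ∀ k, seriesTerm μ p ω s l K n k ≤
      ∫⁻ t in B k, 2 ^ p.toReal * ‖l n * f ((s n)⁻¹ * t)‖ₑ ^ p.toReal ∂ν := fun k => by
    by_cases hk : n = k
    · simp [seriesTerm, hk]
    · rw [seriesTerm, if_neg hk, localNorm_rpow hp hω]
      have hBk : B k = (s n * (s k)⁻¹) • K k := by simp [hB, hk]
      rw [← hBk, ← setLIntegral_const]
      refine setLIntegral_mono' (hBm k) fun t ht => ?_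
      rw [← ENNReal.mul_rpow_of_nonneg _ _ hp0.le, ← Real.div_rpow (norm_nonneg _) (norm_nonneg _),
        ← ENNReal.ofReal_rpow_of_nonneg (by positivity) hp0.le]
      refine ENNReal.rpow_le_rpow ?_ hp0.le
      rw [hBk, mem_smul_set_iff_inv_smul_mem] at ht
      have h1 := hl k _ ht
      simp only [smul_eq_mul, mul_inv_rev, inv_inv, mul_assoc, inv_mul_cancel_left] at h1
      rw [norm_mul] at h1
      have hlk : 0 < ‖l k‖ := by
        refine (norm_nonneg _).lt_of_ne fun h0 => ?_
        rw [← h0] at h1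
        norm_num at h1
      rw [← ofReal_norm, ← ENNReal.ofReal_ofNat 2, ← ENNReal.ofReal_mul (by norm_num)]
      refine ENNReal.ofReal_le_ofReal ?_
      rw [norm_mul, div_le_iff₀ hlk]
      have := mul_le_mul_of_nonneg_left h1 (norm_nonneg (l n))
      linarith
  calc ∑' k, seriesTerm μ p ω s l K n k
      ≤ ∑' k, ∫⁻ t in B k, 2 ^ p.toReal * ‖l n * f ((s n)⁻¹ * t)‖ₑ ^ p.toReal ∂ν :=
        ENNReal.tsum_le_tsum hterm
    _ = ∫⁻ t in ⋃ k, B k, 2 ^ p.toReal * ‖l n * f ((s n)⁻¹ * t)‖ₑ ^ p.toReal ∂ν :=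
        (lintegral_iUnion hBm hdisj _).symm
    _ ≤ ∫⁻ t in (F n)ᶜ, 2 ^ p.toReal * ‖l n * f ((s n)⁻¹ * t)‖ₑ ^ p.toReal ∂ν :=
        lintegral_mono_set (iUnion_subset hBF)
    _ = _ := lintegral_const_mul' _ _ h2top

/-- One step of the construction: the translation is chosen outside a given compact set. -/
theorem IsDenseVector.exists_translation [NoncompactSpace G] [Fact (1 ≤ p)] (hp : p ≠ ∞)
    {hω : IsWeight μ p ω} {hS : IsAdmissible μ ω S} {f : WeightedLp μ p ω}
    (hf : IsDenseVector hω hS Γ f) {F : Set G} (hF : IsCompact F) (hFpos : 0 < μ F)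
    {C : Set G} (hC : IsCompact C) {ε : ℝ≥0∞} (hε : ε ≠ 0) {δ : ℝ} (hδ : 0 < δ) :
    ∃ (s : G) (c : ℂ) (K : Set G), s ∈ S ∧ c ∈ Γ \ {0} ∧ IsCompact K ∧ K ⊆ F ∧
      μ (F \ K) < ENNReal.ofReal δ ∧ s ∉ C ∧ (∀ t ∈ K, 1 / 2 ≤ ‖c * f (s⁻¹ * t)‖) ∧
      ∫⁻ t in Fᶜ, ‖c * f (s⁻¹ * t)‖ₑ ^ p.toReal ∂(weightedMeasure μ p ω) < ε := by
  -- The minimum with `μ F` keeps `K` nonempty, whence `c ≠ 0`.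
  set b := min (ENNReal.ofReal δ) (μ F) with hbdef
  have hb : b / 2 ≠ 0 := (ENNReal.half_pos (lt_min (ENNReal.ofReal_pos.2 hδ) hFpos).ne').ne'
  obtain ⟨c, hc, s, hs, hsC, hint, hmeas⟩ := hf.exists_approx_indicator hp hF hFpos hC hε hb
  set A := {t ∈ F | 1 / 2 ≤ ‖c * f (s⁻¹ * t) - 1‖} with hA
  have hAm : MeasurableSet A := hF.measurableSet.inter (measurableSet_le measurable_const
    ((((coeFn_measurable f).comp (measurable_const_mul s⁻¹)).const_mul c).sub_const 1).norm)
  obtain ⟨K, hKsub, hK, hKm⟩ := (hF.measurableSet.diff hAm).exists_isCompact_sdiff_lt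
    ((measure_mono sdiff_subset).trans_lt (hF.measure_lt_top (μ := μ))).ne hb
  have hdiff : μ (F \ K) < b := by
    have hsub : F \ K ⊆ A ∪ ((F \ A) \ K) := fun t ht => by
      by_cases h : t ∈ A
      · exact Or.inl h
      · exact Or.inr ⟨⟨ht.1, h⟩, ht.2⟩
    calc μ (F \ K) ≤ _ := measure_mono hsub
      _ ≤ _ := measure_union_le _ _
      _ < b / 2 + b / 2 := ENNReal.add_lt_add hmeas hKm
      _ = b := ENNReal.add_halves b
  have hhalf : ∀ t ∈ K, 1 / 2 ≤ ‖c * f (s⁻¹ * t)‖ := fun t ht => by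
    have h1 : ‖c * f (s⁻¹ * t) - 1‖ < 1 / 2 := by
      by_contra! h
      exact (hKsub ht).2 ⟨(hKsub ht).1, h⟩
    have h2 := norm_sub_norm_le (1 : ℂ) (c * f (s⁻¹ * t))
    rw [norm_one, norm_sub_rev] at h2
    linarith
  refine ⟨s, c, K, hs, ⟨hc, fun h0 => ?_⟩, hK, hKsub.trans sdiff_subset,
    hdiff.trans_le (min_le_left _ _), hsC, hhalf, hint⟩
  obtain ⟨t, ht⟩ : K.Nonempty := by
    rw [nonempty_iff_ne_empty]
    rintro rfl
    rw [sdiff_empty] at hdiff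
    exact (hdiff.trans_le (min_le_right _ _)).false
  have := hhalf t ht
  rw [mem_singleton_iff.1 h0] at this
  norm_num at this

theorem IsDenseVector.seriesCondition [NoncompactSpace G] [Fact (1 ≤ p)] (hp : p ≠ ∞)
    {hω : IsWeight μ p ω} {hS : IsAdmissible μ ω S} {f : WeightedLp μ p ω}
    (hf : IsDenseVector hω hS Γ f) : SeriesCondition μ p ω S Γ := by
  intro F δ _ hF hδ
  have hp0 := toReal_pos_of_fact hp
  obtain ⟨ε, hε, hεsum⟩ := ENNReal.exists_pos_sum_of_countable' one_ne_zero ℕ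
  set ν := weightedMeasure μ p ω with hν
  -- `F 0` is arbitrary. With `∅` in its place, index `0` imposes no disjointness, and row `0` is
  -- bounded by the integral of `‖f‖ ^ p` over all of `G`.
  let E : ℕ → Set G := fun n => if n = 0 then ∅ else F n
  have hE0 : E 0 = ∅ := if_pos rfl
  have hEn : ∀ n, 1 ≤ n → E n = F n := fun n hn => if_neg (by omega)
  have hEc : ∀ n, IsCompact (E n) := fun n => by
    rcases Nat.eq_zero_or_pos n with rfl | hn
    · rw [hE0]; exact isCompact_empty
    · rw [hEn n hn]; exact (hF n hn).1
  obtain ⟨x, hx⟩ := exists_seq_of_forall_exists (α := G × ℂ × Set G)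
    (fun n x => (n = 0 → x = (1, 1, ∅)) ∧ (1 ≤ n → x.1 ∈ S ∧ x.2.1 ∈ Γ \ {0} ∧ IsCompact x.2.2 ∧
      x.2.2 ⊆ F n ∧ μ (F n \ x.2.2) < ENNReal.ofReal (δ n) ∧
      (∀ t ∈ x.2.2, 1 / 2 ≤ ‖x.2.1 * f (x.1⁻¹ * t)‖) ∧
      ∫⁻ t in (F n)ᶜ, ‖x.2.1 * f (x.1⁻¹ * t)‖ₑ ^ p.toReal ∂ν < ε n))
    -- This says that `s_n⁻¹ E_n` and `s_k⁻¹ E_k` are disjoint: `s_n⁻¹ a = s_k⁻¹ b` exactly when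
    -- `s_n = a b⁻¹ s_k`. The set to avoid is compact.
    (fun n k x y => x.1 ∉ E n * (E k)⁻¹ * {y.1}) (fun n x => by
      rcases Nat.eq_zero_or_pos n with rfl | hn
      · exact ⟨(1, 1, ∅), ⟨fun _ => rfl, fun h => absurd h (by norm_num)⟩, fun k hk =>
          absurd hk (Nat.not_lt_zero k)⟩
      · have hC : IsCompact (⋃ k ∈ Finset.range n, E n * (E k)⁻¹ * {(x k).1}) :=
          (Finset.range n).isCompact_biUnion fun k _ =>
            ((hEc n).mul (hEc k).inv).mul isCompact_singleton
        obtain ⟨s, c, K, hs, hc, hK, hKF, hKm, hsC, hhalf, hint⟩ :=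
          hf.exists_translation hp (hF n hn).1 (hF n hn).2 hC (hε n).ne' (hδ n hn)
        refine ⟨(s, c, K), ⟨fun h => by omega, fun _ => ⟨hs, hc, hK, hKF, hKm, hhalf, hint⟩⟩,
          fun k hk hk' => hsC ?_⟩
        exact mem_biUnion (Finset.mem_coe.2 (Finset.mem_range.2 hk)) hk')
  have h0 : x 0 = (1, 1, ∅) := (hx 0).1.1 rfl
  have hdisj : Pairwise (Function.onFun Disjoint fun k => (x k).1⁻¹ • E k) := by
    have key : ∀ n k, k < n → Disjoint ((x n).1⁻¹ • E n) ((x k).1⁻¹ • E k) := by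
      intro n k hk
      rw [disjoint_left]
      rintro _ ⟨a, ha, rfl⟩ ⟨b, hb, hab⟩
      refine (hx n).2 k hk ⟨a * b⁻¹, ⟨a, ha, b⁻¹, inv_mem_inv.2 hb, rfl⟩, _, rfl, ?_⟩
      simp only [smul_eq_mul] at hab ⊢
      have : b = (x k).1 * ((x n).1⁻¹ * a) := by rw [← hab]; simp
      rw [this]
      group
    intro n k hnk
    rcases lt_or_gt_of_ne hnk with h | h
    · exact (key k n h).symm
    · exact key n k h
  have hprop := fun n hn => (hx n).1.2 hn
  have hKE : ∀ k, (x k).2.2 ⊆ E k := fun k => by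
    rcases Nat.eq_zero_or_pos k with rfl | hk
    · simp [h0]
    · rw [hEn k hk]; exact (hprop k hk).2.2.2.1
  have hhalf : ∀ k, ∀ t ∈ (x k).2.2, 1 / 2 ≤ ‖(x k).2.1 * f ((x k).1⁻¹ * t)‖ := fun k => by
    rcases Nat.eq_zero_or_pos k with rfl | hk
    · simp [h0]
    · exact (hprop k hk).2.2.2.2.2.1
  have hKm : ∀ k, MeasurableSet (x k).2.2 := fun k => by
    rcases Nat.eq_zero_or_pos k with rfl | hk
    · simp [h0]
    · exact (hprop k hk).2.2.1.measurableSet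
  refine ⟨fun n => (x n).1, fun n => (x n).2.1, fun n => (x n).2.2, by simp [h0], by simp [h0],
    by simp [h0], fun n hn => ?_, fun n hn k hk hnk => ?_, ?_⟩
  · obtain ⟨h1, h2, h3, h4, h5, -⟩ := hprop n hn
    exact ⟨h1, h2, h3, h4, h5⟩
  · have := hdisj hnk
    simp only [Function.onFun, hEn n hn, hEn k hk] at this
    exact this
  · have h2top : (2 : ℝ≥0∞) ^ p.toReal ≠ ∞ := ENNReal.rpow_ne_top_of_nonneg hp0.le (by simp)
    set I := ∫⁻ t, ‖f t‖ₑ ^ p.toReal ∂ν with hI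
    have hItop : I < ∞ := by
      have := lintegral_rpow_enorm_lt_top_of_eLpNorm_lt_top
        (zero_lt_one.trans_le (Fact.out : 1 ≤ p)).ne' hp (Lp.memLp f).2
      exact this
    have hrow : ∀ n, ∑' k, seriesTerm μ p ω (fun n => (x n).1) (fun n => (x n).2.1)
        (fun n => (x n).2.2) n k ≤ 2 ^ p.toReal * ((if n = 0 then I else 0) + ε n) := by
      intro n
      refine (tsum_seriesTerm_le hp hω hKm hKE hdisj hhalf n).trans ?_
      gcongr
      rcases Nat.eq_zero_or_pos n with rfl | hn
      · simp [h0, hE0, hI, hν]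
      · rw [if_neg (by omega), zero_add]
        simp only [hEn n hn]
        exact (hprop n hn).2.2.2.2.2.2.le
    calc _ ≤ ∑' n, 2 ^ p.toReal * ((if n = 0 then I else 0) + ε n) := ENNReal.tsum_le_tsum hrow
      _ = 2 ^ p.toReal * (I + ∑' n, ε n) := by
        rw [ENNReal.tsum_mul_left, ENNReal.tsum_add, tsum_ite_eq]
      _ < ∞ := ENNReal.mul_lt_top h2top.lt_top
        (ENNReal.add_lt_top.2 ⟨hItop, hεsum.trans ENNReal.one_lt_top⟩)

end


/-! ### From the double series to dense joint orbits. -/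

open Filter Topology

/-- A convergent series stays convergent after multiplication by a suitable unbounded sequence of
multiplicities. -/
theorem exists_tendsto_atTop_tsum_mul_ne_top {c : ℕ → ℝ≥0∞} (hc : ∑' n, c n ≠ ∞) :
    ∃ D : ℕ → ℕ, (∀ n, D n ≤ n) ∧ Tendsto D atTop atTop ∧ ∑' n, (D n : ℝ≥0∞) * c n ≠ ∞ := by
  obtain ⟨ε, hε, hεsum⟩ := ENNReal.exists_pos_sum_of_countable' one_ne_zero ℕ
  have hN : ∀ j, ∃ N, ∑' k, c (k + N) < ε j := fun j =>
    ((ENNReal.tendsto_sum_nat_add c hc).eventually_lt_const (hε j)).exists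
  choose N hN using hN
  -- `D k` counts the tail thresholds `N j`, `j < k`, already passed by `k`. Exchanging sums bounds
  -- `∑ D k * c k` by the sum over `j` of the tails from `N j`, each below `ε j`.
  refine ⟨fun k => ((Finset.range k).filter fun j => N j ≤ k).card, fun k => ?_, ?_, ?_⟩
  · exact (Finset.card_filter_le _ _).trans (Finset.card_range k).le
  · refine tendsto_atTop.2 fun J => ?_
    have h : ∀ᶠ k in atTop, ∀ j ∈ Finset.range J, N j ≤ k :=
      (Filter.eventually_all_finset _).2 fun j _ => eventually_ge_atTop (N j)
    filter_upwards [h, eventually_ge_atTop J] with k hk hJ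
    calc J = (Finset.range J).card := (Finset.card_range J).symm
      _ ≤ _ := Finset.card_le_card fun j hj => Finset.mem_filter.2
        ⟨Finset.mem_range.2 ((Finset.mem_range.1 hj).trans_le hJ), hk j hj⟩
  · refine ne_top_of_le_ne_top (hεsum.trans ENNReal.one_lt_top).ne ?_
    calc ∑' k, ((((Finset.range k).filter fun j => N j ≤ k).card : ℕ) : ℝ≥0∞) * c k
        ≤ ∑' k, ∑' j, (if N j ≤ k then c k else 0) := by
          refine ENNReal.tsum_le_tsum fun k => ?_
          refine le_trans (le_of_eq ?_)
            (ENNReal.sum_le_tsum ((Finset.range k).filter fun j => N j ≤ k))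
          rw [Finset.sum_congr rfl fun j hj => if_pos (Finset.mem_filter.1 hj).2,
            Finset.sum_const, nsmul_eq_mul]
      _ = ∑' j, ∑' k, (if N j ≤ k then c k else 0) := ENNReal.tsum_comm
      _ ≤ ∑' j, ε j := by
          refine ENNReal.tsum_le_tsum fun j => (le_of_eq ?_).trans (hN j).le
          rw [← (ENNReal.summable (f := fun k => if N j ≤ k + N j then c (k + N j) else 0)
            ).sum_add_tsum_nat_add' (f := fun k => if N j ≤ k then c k else 0)]
          rw [Finset.sum_eq_zero fun k hk => if_neg (by simpa using hk)]
          simp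

theorem exists_measurable_eqOn_of_pairwise_disjoint {α : Type*} [MeasurableSpace α]
    {B : ℕ → Set α} (hB : ∀ k, MeasurableSet (B k)) (hd : Pairwise (Function.onFun Disjoint B))
    {h : ℕ → α → ℂ} (hh : ∀ k, Measurable (h k)) :
    ∃ f : α → ℂ, Measurable f ∧ (∀ k, EqOn f (h k) (B k)) ∧ ∀ x, (∀ k, x ∉ B k) → f x = 0 := by
  obtain ⟨f, hf, hfB⟩ := exists_measurable_piecewise B hB h hh fun i j hij x hx =>
    (disjoint_left.1 (hd hij) hx.1 hx.2).elim
  refine ⟨(⋃ k, B k).indicator f, hf.indicator (MeasurableSet.iUnion hB), fun k x hx => ?_,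
    fun x hx => indicator_of_notMem (by simpa using hx) _⟩
  rw [indicator_of_mem (mem_iUnion.2 ⟨k, hx⟩), hfB k hx]

/-- Truncations of a `p`-integrable function to sets exhausting the space converge to it. -/
theorem tendsto_lintegral_indicator_sub {α : Type*} [MeasurableSpace α] {ν : Measure α} {q : ℝ}
    (hq : 0 < q) {d : α → ℂ} (hd : Measurable d) (hint : ∫⁻ t, ‖d t‖ₑ ^ q ∂ν ≠ ∞)
    {A : ℕ → Set α} (hA : ∀ n, MeasurableSet (A n)) (hmem : ∀ t, ∀ᶠ n in atTop, t ∈ A n) :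
    Tendsto (fun n => ∫⁻ t, ‖(A n).indicator d t - d t‖ₑ ^ q ∂ν) atTop (𝓝 0) := by
  have h := tendsto_lintegral_of_dominated_convergence (μ := ν)
    (F := fun n t => ‖(A n).indicator d t - d t‖ₑ ^ q) (f := fun _ => 0) (fun t => ‖d t‖ₑ ^ q)
    (fun n => (((hd.indicator (hA n)).sub hd).enorm).pow_const q)
    (fun n => ae_of_all _ fun t => by
      by_cases ht : t ∈ A n
      · simp [ht, hq]
      · simp [ht]) hint
    (ae_of_all _ fun t => tendsto_const_nhds.congr' (by
      filter_upwards [hmem t] with n hn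
      simp [hn, hq]))
  simpa using h

section

variable {G : Type*} [Group G] [TopologicalSpace G] [IsTopologicalGroup G] [T2Space G]
  [LocallyCompactSpace G] [SecondCountableTopology G] [MeasurableSpace G] [BorelSpace G]
  {μ : Measure G} [μ.IsHaarMeasure] {p : ℝ≥0∞} {ω : G → ℝ} {S : Set G} {Γ : Set ℂ}

/-- A function assembled from dilated translates of the `g k` on pairwise disjoint sets has
translates close to the `g n`. -/
theorem exists_translates_approx [Fact (1 ≤ p)] (hp : p ≠ ∞) (hω : IsWeight μ p ω)
    {s : ℕ → G} {l : ℕ → ℂ} {K F : ℕ → Set G} {D : ℕ → ℝ≥0∞}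
    (hK : ∀ k, MeasurableSet (K k)) (hF : ∀ k, MeasurableSet (F k)) (hKF : ∀ k, K k ⊆ F k)
    (hdisj : Pairwise (Function.onFun Disjoint fun k => (s k)⁻¹ • F k)) (hl : ∀ k, l k ≠ 0)
    {g : ℕ → G → ℂ} (hg : ∀ k, Measurable (g k)) (hgF : ∀ k, ∀ t ∉ F k, g k t = 0)
    (hgD : ∀ k t, ‖g k t‖ₑ ^ p.toReal ≤ D k) :
    ∃ f : G → ℂ, Measurable f ∧ ∀ n,
      ∫⁻ t, ‖l n * f ((s n)⁻¹ * t) - g n t‖ₑ ^ p.toReal ∂(weightedMeasure μ p ω) ≤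
        D n * weightedMeasure μ p ω (F n \ K n) + ∑' k, D k * seriesTerm μ p ω s l K n k := by
  have hp0 := toReal_pos_of_fact hp
  set ν := weightedMeasure μ p ω
  obtain ⟨f, hfm, hfB, hf0⟩ := exists_measurable_eqOn_of_pairwise_disjoint
    (B := fun k => (s k)⁻¹ • K k) (fun k => (hK k).const_smul _)
    (fun i j hij => (hdisj hij).mono (smul_set_mono (hKF i)) (smul_set_mono (hKF j)))
    (h := fun k x => (l k)⁻¹ * g k (s k * x))
    (fun k => ((hg k).comp (measurable_const_mul _)).const_mul _)
  refine ⟨f, hfm, fun n => ?_⟩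
  set a : ℕ → ℝ≥0∞ := fun k =>
    if n = k then 0 else ENNReal.ofReal (‖l n‖ ^ p.toReal / ‖l k‖ ^ p.toReal) with ha
  have hterm : ∀ k, seriesTerm μ p ω s l K n k = a k * ν ((s n * (s k)⁻¹) • K k) := fun k => by
    by_cases hk : n = k
    · simp [seriesTerm, ha, hk]
    · simp only [seriesTerm, ha, if_neg hk, localNorm_rpow hp hω]
      rfl
  -- Three cases: on `K n` the error vanishes; on `s_n s_k⁻¹ K_k` with `k ≠ n`, a set off `F n`, it
  -- is `(l n / l k)` times a value of `g k`; elsewhere `f` contributes nothing and the error is `g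
  -- n`, which can be nonzero only on `F n \ K n`.
  have hpt : ∀ t, ‖l n * f ((s n)⁻¹ * t) - g n t‖ₑ ^ p.toReal ≤
      (F n \ K n).indicator (fun _ => D n) t +
        ∑' k, ((s n * (s k)⁻¹) • K k).indicator (fun _ => D k * a k) t := by
    intro t
    by_cases hx : ∃ k, (s n)⁻¹ * t ∈ (s k)⁻¹ • K k
    · obtain ⟨k, hk⟩ := hx
      rw [hfB k hk]
      by_cases hnk : n = k
      · subst hnk
        simp [mul_inv_cancel_left₀ (hl n), hp0]
      · have hmem : t ∈ (s n * (s k)⁻¹) • K k := by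
          rw [mem_smul_set_iff_inv_smul_mem] at hk ⊢
          simpa [mul_assoc] using hk
        have htF : t ∉ F n := fun ht =>
          disjoint_left.1 (hdisj hnk) (smul_mem_smul_set ht) (smul_set_mono (hKF k) hk)
        refine le_trans ?_ (le_add_left (ENNReal.le_tsum k))
        rw [hgF n t htF, sub_zero, indicator_of_mem hmem, ← mul_assoc, enorm_mul,
          ENNReal.mul_rpow_of_nonneg _ _ hp0.le, mul_comm]
        refine mul_le_mul' (hgD k _) (le_of_eq ?_)
        simp only [ha, if_neg hnk]
        rw [← Real.div_rpow (norm_nonneg _) (norm_nonneg _),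
          ← ENNReal.ofReal_rpow_of_nonneg (by positivity) hp0.le, ← ofReal_norm, norm_mul,
          norm_inv, div_eq_mul_inv]
    · push Not at hx
      rw [hf0 _ hx, mul_zero, zero_sub, enorm_neg]
      refine le_trans ?_ le_self_add
      by_cases ht : t ∈ F n
      · have htK : t ∈ F n \ K n := ⟨ht, fun htK => hx n (smul_mem_smul_set htK)⟩
        rw [indicator_of_mem htK]
        exact hgD n t
      · rw [hgF n t ht, enorm_zero, ENNReal.zero_rpow_of_pos hp0]
        exact zero_le
  have hBm : ∀ k, MeasurableSet ((s n * (s k)⁻¹) • K k) := fun k => (hK k).const_smul _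
  calc ∫⁻ t, ‖l n * f ((s n)⁻¹ * t) - g n t‖ₑ ^ p.toReal ∂ν
      ≤ ∫⁻ t, ((F n \ K n).indicator (fun _ => D n) t +
        ∑' k, ((s n * (s k)⁻¹) • K k).indicator (fun _ => D k * a k) t) ∂ν := lintegral_mono hpt
    _ = D n * ν (F n \ K n) + ∑' k, D k * a k * ν ((s n * (s k)⁻¹) • K k) := by
      rw [lintegral_add_left (measurable_const.indicator ((hF n).diff (hK n))),
        lintegral_indicator_const ((hF n).diff (hK n)),
        lintegral_tsum fun k => (measurable_const.indicator (hBm k)).aemeasurable]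
      simp only [lintegral_indicator_const (hBm _)]
    _ = _ := by simp only [hterm, mul_assoc]

/-- The targets are unbounded, whereas the series controls only bounded ones. Truncating the `n`-th
target at a height tending to infinity slowly enough keeps the total error summable, so the errors
tend to `0`. -/
theorem SeriesCondition.exists_dense_jointOrbit {ι : Type*} [Fintype ι] [Fact (1 ≤ p)]
    (hp : p ≠ ∞) (hω : IsWeight μ p ω) (hS : IsAdmissible μ ω S)
    (h : SeriesCondition μ p ω S Γ) :
    ∃ f : ι → WeightedLp μ p ω, Dense (jointOrbit hω hS Γ f) := by
  have hp0 := toReal_pos_of_fact hp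
  have : Fact (p ≠ ∞) := ⟨hp⟩
  have := hω.isFiniteMeasureOnCompacts hp
  have hp1 : p ≠ 0 := (zero_lt_one.trans_le (Fact.out : 1 ≤ p)).ne'
  set ν := weightedMeasure μ p ω with hν
  let d : ℕ → ι → WeightedLp μ p ω := TopologicalSpace.denseSeq _
  have hd : DenseRange d := TopologicalSpace.denseRange_denseSeq _
  obtain ⟨ε, hε, hεsum⟩ := ENNReal.exists_pos_sum_of_countable' one_ne_zero ℕ
  -- the compact sets
  obtain ⟨K₀, hK₀, hK₀'⟩ := exists_compact_mem_nhds (1 : G)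
  -- `K₀` gives positive measure from `n = 1` on. The choice `F 0 = ∅` makes the target of index `0`
  -- zero.
  let F : ℕ → Set G := fun n => if n = 0 then ∅ else K₀ ∪ compactCovering G n
  have hF1 : ∀ n, 1 ≤ n → F n = K₀ ∪ compactCovering G n := fun n hn => if_neg (by omega)
  have hF0 : F 0 = ∅ := if_pos rfl
  have hFc : ∀ n, IsCompact (F n) := fun n => by
    rcases Nat.eq_zero_or_pos n with rfl | hn
    · rw [hF0]; exact isCompact_empty
    · rw [hF1 n hn]; exact hK₀.union (isCompact_compactCovering G n)
  have hFmem : ∀ t, ∀ᶠ n in atTop, t ∈ F n := fun t => by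
    obtain ⟨m, hm⟩ := exists_mem_compactCovering t
    filter_upwards [eventually_ge_atTop m, eventually_ge_atTop 1] with n hn hn1
    rw [hF1 n hn1]
    exact Or.inr (compactCovering_subset G hn hm)
  -- The divisor `n + 1` absorbs the factor `D n ≤ n` later.
  have hδ : ∀ n, ∃ δ : ℝ, 0 < δ ∧ ∀ A ⊆ F n, μ A < ENNReal.ofReal δ → ν A < ε n / (n + 1) := by
    intro n
    obtain ⟨δ, hδ, H⟩ := exists_pos_measure_lt_of_absolutelyContinuous
      (weightedMeasure_absolutelyContinuous (μ := μ) (p := p) (ω := ω))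
      ((hFc n).measure_lt_top (μ := ν)).ne
      (ENNReal.div_pos (hε n).ne' (by finiteness : (n : ℝ≥0∞) + 1 ≠ ∞)).ne'
    obtain ⟨r, hr0, hr⟩ := ENNReal.lt_iff_exists_nnreal_btwn.1 hδ
    refine ⟨r, by exact_mod_cast hr0, fun A hA hAr => H A hA (hAr.trans ?_)⟩
    rwa [ENNReal.ofReal_coe_nnreal]
  choose δ hδ0 hδ using hδ
  obtain ⟨s, l, K, hs0, hl0, hK0, hn1, hdisj, hsum⟩ := h F δ
    (fun m hm n hn hmn => by
      rw [hF1 m hm, hF1 n hn]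
      exact union_subset_union_right _ (compactCovering_subset G hmn))
    (fun n hn => ⟨hFc n, by
      rw [hF1 n hn]
      exact (Measure.measure_pos_of_mem_nhds μ hK₀').trans_le (measure_mono subset_union_left)⟩)
    (fun n _ => hδ0 n)
  have hKm : ∀ k, MeasurableSet (K k) := fun k => by
    rcases Nat.eq_zero_or_pos k with rfl | hk
    · simp [hK0]
    · exact (hn1 k hk).2.2.1.measurableSet
  have hKF : ∀ k, K k ⊆ F k := fun k => by
    rcases Nat.eq_zero_or_pos k with rfl | hk
    · simp [hK0]
    · exact (hn1 k hk).2.2.2.1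
  have hl : ∀ k, l k ≠ 0 := fun k => by
    rcases Nat.eq_zero_or_pos k with rfl | hk
    · simp [hl0]
    · exact (hn1 k hk).2.1.2
  have hdisj' : Pairwise (Function.onFun Disjoint fun k => (s k)⁻¹ • F k) := fun i j hij => by
    rcases Nat.eq_zero_or_pos i with rfl | hi
    · simp [Function.onFun, hF0]
    rcases Nat.eq_zero_or_pos j with rfl | hj
    · simp [Function.onFun, hF0]
    exact hdisj hi hj hij
  -- The weight `D k` multiplies the `k`-th column, so column sums are needed.
  rw [ENNReal.tsum_comm] at hsum
  obtain ⟨D, hDn, hDtop, hDsum⟩ := exists_tendsto_atTop_tsum_mul_ne_top hsum.ne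
  -- the truncated targets
  let A : ℕ → ℕ → ι → Set G := fun m n i => F n ∩ {t | ‖d m i t‖ₑ ^ p.toReal ≤ (D n : ℝ≥0∞)}
  have hA : ∀ m n i, MeasurableSet (A m n i) := fun m n i => (hFc n).measurableSet.inter
    (measurableSet_le ((coeFn_measurable (d m i)).enorm.pow_const _) measurable_const)
  have hAmem : ∀ m i t, ∀ᶠ n in atTop, t ∈ A m n i := fun m i t => by
    obtain ⟨M, hM⟩ := ENNReal.exists_nat_gt
      (ENNReal.rpow_ne_top_of_nonneg hp0.le (enorm_ne_top (x := d m i t)))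
    filter_upwards [hFmem t, hDtop.eventually_ge_atTop M] with n hn hn'
    exact ⟨hn, hM.le.trans (by exact_mod_cast hn')⟩
  -- Unpairing makes every target `d m` recur at arbitrarily large indices.
  let g : ℕ → ι → G → ℂ := fun n i => (A n.unpair.1 n i).indicator (d n.unpair.1 i)
  have hgLp : ∀ n i, MemLp (g n i) p ν := fun n i => (Lp.memLp _).indicator (hA _ _ _)
  have hf : ∀ i, ∃ f : G → ℂ, Measurable f ∧ ∀ n,
      ∫⁻ t, ‖l n * f ((s n)⁻¹ * t) - g n i t‖ₑ ^ p.toReal ∂ν ≤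
        D n * ν (F n \ K n) + ∑' k, D k * seriesTerm μ p ω s l K n k := fun i =>
    exists_translates_approx hp hω hKm (fun k => (hFc k).measurableSet) hKF hdisj' hl
      (fun k => (coeFn_measurable _).indicator (hA _ _ _))
      (fun k t ht => indicator_of_notMem (fun h => ht h.1) _)
      (fun k t => by
        by_cases ht : t ∈ A k.unpair.1 k i
        · simp only [g, indicator_of_mem ht]
          exact ht.2
        · simp only [g, indicator_of_notMem ht, enorm_zero, ENNReal.zero_rpow_of_pos hp0]
          exact zero_le)
  choose f hfm hf using hf
  set R : ℕ → ℝ≥0∞ := fun n => D n * ν (F n \ K n) + ∑' k, D k * seriesTerm μ p ω s l K n k with hR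
  have hRsum : ∑' n, R n ≠ ∞ := by
    simp only [hR]
    rw [ENNReal.tsum_add, ENNReal.tsum_comm (f := fun n k => (D k : ℝ≥0∞) * _)]
    simp only [ENNReal.tsum_mul_left]
    refine ENNReal.add_ne_top.2 ⟨ne_top_of_le_ne_top (hεsum.trans ENNReal.one_lt_top).ne
      (ENNReal.tsum_le_tsum fun n => ?_), hDsum⟩
    rcases Nat.eq_zero_or_pos n with rfl | hn
    · simp [hF0]
    · calc (D n : ℝ≥0∞) * ν (F n \ K n) ≤ (n + 1) * (ε n / (n + 1)) := by
            gcongr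
            · exact (Nat.cast_le.2 (hDn n)).trans le_self_add
            · exact (hδ n _ sdiff_subset (hn1 n hn).2.2.2.2).le
        _ = ε n := ENNReal.mul_div_cancel (by simp) (by finiteness)
  have hRlim : Tendsto R atTop (𝓝 0) := ENNReal.tendsto_atTop_zero_of_tsum_ne_top hRsum
  have hfLp : ∀ i, MemLp (f i) p ν := fun i => by
    refine ⟨(hfm i).aestronglyMeasurable, ?_⟩
    rw [eLpNorm_lt_top_iff_lintegral_rpow_enorm_lt_top hp1 hp]
    -- As `s 0 = 1`, `l 0 = 1` and `g 0 = 0`, the error estimate at index `0` bounds the norm of `f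
    -- i` itself.
    have hg0 : ∀ t, g 0 i t = 0 := fun t => indicator_of_notMem (fun h => by simp [A, hF0] at h) _
    have := (hf i 0).trans_lt (ENNReal.ne_top_of_tsum_ne_top hRsum 0).lt_top
    simpa [hl0, hs0, hg0] using this
  refine ⟨fun i => (hfLp i).toLp (f i), Metric.dense_iff.2 fun y r hr => ?_⟩
  obtain ⟨m, hm⟩ := Metric.denseRange_iff.1 hd y (r / 2) (by positivity)
  have hr4 : 0 < ENNReal.ofReal (r / 4) ^ p.toReal :=
    ENNReal.rpow_pos (ENNReal.ofReal_pos.2 (by positivity)) ENNReal.ofReal_ne_top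
  have htrunc : ∀ᶠ n in atTop, ∀ i,
      ∫⁻ t, ‖(A m n i).indicator (d m i) t - d m i t‖ₑ ^ p.toReal ∂ν <
        ENNReal.ofReal (r / 4) ^ p.toReal := by
    refine eventually_all.2 fun i => ?_
    refine (tendsto_lintegral_indicator_sub hp0 (coeFn_measurable (d m i)) ?_ (fun n => hA m n i)
      (hAmem m i)).eventually_lt_const hr4
    exact (lintegral_rpow_enorm_lt_top_of_eLpNorm_lt_top hp1 hp (Lp.memLp (d m i)).2).ne
  have hfreq : ∃ᶠ n : ℕ in atTop, n.unpair.1 = m :=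
    frequently_atTop.2 fun a => ⟨Nat.pair m a, Nat.right_le_pair m a, by simp⟩
  obtain ⟨n, hnm, hntr, hnR, hn⟩ := (hfreq.and_eventually
    (htrunc.and ((hRlim.eventually_lt_const hr4).and (eventually_ge_atTop 1)))).exists
  have hsS := (hn1 n hn).1
  refine ⟨l n • fun i => translate hω (s n) (hS _ hsS) ((hfLp i).toLp (f i)), ?_,
    l n, (hn1 n hn).2.1.1, s n, hsS, rfl⟩
  rw [Metric.mem_ball, dist_pi_lt_iff hr]
  intro i
  have hlt : ∀ u v : WeightedLp μ p ω, ∫⁻ t, ‖u t - v t‖ₑ ^ p.toReal ∂ν <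
      ENNReal.ofReal (r / 4) ^ p.toReal → dist u v < r / 4 := fun u v huv => by
    rw [← edist_rpow_toReal hp, ENNReal.rpow_lt_rpow_iff hp0] at huv
    exact edist_lt_ofReal.1 huv
  have h1 : dist (l n • translate hω (s n) (hS _ hsS) ((hfLp i).toLp (f i)))
      ((hgLp n i).toLp (g n i)) < r / 4 := by
    refine hlt _ _ (lt_of_eq_of_lt (lintegral_congr_ae ?_) ((hf i n).trans_lt hnR))
    -- Replacing the class of `f i` by `f i` after translation requires translates of `ν`-null sets
    -- to be null; this holds since `ν` and the invariant `μ` have the same null sets.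
    have hqmp : Measure.QuasiMeasurePreserving (fun t => (s n)⁻¹ * t) ν ν :=
      ⟨measurable_const_mul _, (weightedMeasure_absolutelyContinuous.map
        (measurable_const_mul _)).trans (by
          rw [map_mul_left_eq_self]; exact hω.absolutelyContinuous)⟩
    filter_upwards [Lp.coeFn_smul (l n) (translate hω (s n) (hS _ hsS) ((hfLp i).toLp (f i))),
      coeFn_translate hω (s n) (hS _ hsS) ((hfLp i).toLp (f i)), (hgLp n i).coeFn_toLp,
      hqmp.ae_eq_comp (hfLp i).coeFn_toLp] with t h1 h2 h3 h4
    simp only [Function.comp] at h4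
    rw [h1, h3, Pi.smul_apply, h2, h4, smul_eq_mul]
  have h2 : dist ((hgLp n i).toLp (g n i)) (d m i) < r / 4 := by
    refine hlt _ _ (lt_of_eq_of_lt (lintegral_congr_ae ?_) (hntr i))
    filter_upwards [(hgLp n i).coeFn_toLp] with t h3
    rw [h3]
    simp only [g, hnm]
  have h3 : dist (d m i) (y i) < r / 2 := by
    rw [dist_comm]
    exact (dist_le_pi_dist y (d m) i).trans_lt hm
  have h4 := dist_triangle4 (l n • translate hω (s n) (hS _ hsS) ((hfLp i).toLp (f i)))
    ((hgLp n i).toLp (g n i)) (d m i) (y i)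
  rw [Pi.smul_apply]
  linarith

theorem exists_isDenseVector_of_dense_jointOrbit [Fact (1 ≤ p)] {hω : IsWeight μ p ω}
    {hS : IsAdmissible μ ω S} {f : Fin 1 → WeightedLp μ p ω}
    (hf : Dense (jointOrbit hω hS Γ f)) : IsDenseVector hω hS Γ (f 0) := by
  have hsurj : Function.Surjective fun x : Fin 1 → WeightedLp μ p ω => x 0 :=
    fun y => ⟨fun _ => y, rfl⟩
  refine (hsurj.denseRange.dense_image (continuous_apply 0) hf).mono ?_
  rintro _ ⟨_, ⟨c, hc, s, hs, rfl⟩, rfl⟩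
  exact ⟨c, hc, s, hs, rfl⟩

end

end WeightedTranslates

theorem theoremA {G : Type*} [Group G] [TopologicalSpace G] [IsTopologicalGroup G] [T2Space G]
    [LocallyCompactSpace G] [SecondCountableTopology G] [NoncompactSpace G]
    [MeasurableSpace G] [BorelSpace G] (μ : Measure G) [μ.IsHaarMeasure]
    (S : Set G) (p : ℝ≥0∞) [Fact (1 ≤ p)] (hp : p ≠ ∞)
    (Γ : Set ℂ) (hΓ : (Γ \ {0}).Nonempty)
    (ω : G → ℝ) (hω : WeightedTranslates.IsWeight μ p ω)
    (hS : WeightedTranslates.IsAdmissible μ ω S) :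
    List.TFAE [
      ∃ f : WeightedTranslates.WeightedLp μ p ω,
        WeightedTranslates.IsDenseVector hω hS Γ f,
      WeightedTranslates.SeriesCondition μ p ω S Γ,
      ∀ N : ℕ, 1 ≤ N → ∃ f : Fin N → WeightedTranslates.WeightedLp μ p ω,
        Dense (WeightedTranslates.jointOrbit hω hS Γ f)] := by
  tfae_have 1 → 2 := fun ⟨_, hf⟩ => hf.seriesCondition hp
  tfae_have 2 → 3 := fun h _ _ => h.exists_dense_jointOrbit hp hω hS
  tfae_have 3 → 1 := fun h =>
    let ⟨f, hf⟩ := h 1 le_rfl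
    ⟨f 0, WeightedTranslates.exists_isDenseVector_of_dense_jointOrbit hf⟩
  tfae_finish
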